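/- Consider a packing of finitely many non-overlapping disks in the plane, with centers $\mathbf x^i$ and radii $a_i>0$, $i=1,\dots,N$. Its contact graph $\Gamma$ joins $\mathbf x^i,\mathbf x^j$ iff $|\mathbf x^i-\mathbf x^j|=a_i+a_j$; then $j\in\mathcal N_i$ and $\mathbf q^{ij}=(\mathbf x^j-\mathbf x^i)/|\mathbf x^j-\mathbf x^i|$. Let $E$ be the number of edges. Assume that $\Gamma$ is a triangulation of a connected polygonal domain $\Omega$, i.e. the edges of $\Gamma$ cut $\Omega$ into triangles (with no edge entering an open triangle), and every vertex and every edge of $\Gamma$ belongs to one of these triangles. Vertices on $\partial\Omega$ are boundary vertices, the others are interior vertices. The boundary vertices are divided into $M$ groups, each of them being in contact with another one of its own group, and have the prescribed displacements $\mathbf u^i=\mathbf g^i:=\mathbf c^m+\alpha^m K(\mathbf x^i-\mathbf x^{\star,m})$ for $i$ in group $m$, where $K$ is the clockwise rotation by $\pi/2$. Let $\mathbf z$ be the vector of displacements of the interior vertices. For an edge $l=(i,j)$ the quantity $(\mathbf u^j-\mathbf u^i)\cdot\mathbf q^{ij}$ is an affine function $(R\mathbf z+\mathbf a)_l$ of $\mathbf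 z$; this defines the matrix $R$ and the vector $\mathbf a\in\mathbb R^E$. For $d>0$ and $\boldsymbol\delta\in\mathbb R^E$ the reduced problem is $$\text{minimize } F(\mathbf z)=\tfrac12 d^{-3}\,|R\mathbf z+\mathbf a+d\boldsymbol\delta|^2\quad\text{subject to } R\mathbf z+\mathbf a\ge 0 .$$ An edge $l$ is active (solid-like) at $\mathbf z$ if $(R\mathbf z+\mathbf a)_l=0$. Assume: A1. For at least one $d>0$ and $\boldsymbol\delta\in[-1,-1/2]^E$, the minimizer of $F$ without the constraint $R\mathbf z+\mathbf a\ge0$ is not feasible; and the feasible set $\{\mathbf z: R\mathbf z+\mathbf a\ge 0\}$ is nonempty. A2. $\Gamma$ is a regular triangulation: (i) $\Gamma$ is obtained from one triangle by successively adding triangles, each of which either shares an edge with the graph built so far and brings one new vertex and two new edges, or has all its vertices and two of its edges in that graph and brings one new edge; (ii) if an interior vertex $\mathbf x^i$ is connected to a boundary vertex $\mathbf x^j$, then it is also connected to another boundary vertex $\mathbf x^k$ with $\mathbf q^{ij},\mathbf q^{ik}$ linearly independent; (iii) for each set $X$ of at least two interior vertices inducing a connected subgraph of $\Gamma$ there are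 two vertices in $X$ and two vertices of $\Gamma$ not in $X$ that are the four vertices of a union of two adjacent triangles of the triangulation. A3. $|(\mathbf x^i+\mathbf g^i)-(\mathbf x^j+\mathbf g^j)|\le a_i+a_j+\min_k a_k$ for all boundary vertices $\mathbf x^i,\mathbf x^j$ in contact. Then there are $d^\star>0$ and $\boldsymbol\delta\in(-1,-1/2)^E$ such that for every $d>d^\star$ the reduced problem has a unique minimizer, and at this minimizer each interior vertex $\mathbf x^i$ has at least two active incident edges $(i,j_1),(i,j_2)$ with $\mathbf q^{ij_1},\mathbf q^{ij_2}$ linearly independent. Moreover $\boldsymbol\delta$ can be chosen generically: for Lebesgue-almost every $\boldsymbol\delta\in(-1,-1/2)^E$ there is $d^\star>0$ with this property. -/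

import Mathlib

namespace Granular

/-- The Euclidean plane. -/
abbrev Plane : Type := EuclideanSpace ℝ (Fin 2)

/-- Clockwise rotation by `π / 2`, i.e. the matrix `(0 1; -1 0)`. -/
noncomputable def rotK (v : Plane) : Plane := !₂[v 1, -v 0]

/-- A finite packing of non-overlapping disks in the plane: centers `x i`, radii `a i`. -/
structure DiskPacking (ι : Type*) where
  x : ι → Plane
  a : ι → ℝ
  radius_pos : ∀ i, 0 < a i
  nonoverlapping : ∀ i j, i ≠ j → a i + a j ≤ dist (x i) (x j)

/-- The graph on `ι` consisting of the three sides of the triangle `i j k`. -/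
def triangleGraph {ι : Type*} (i j k : ι) : SimpleGraph ι :=
  SimpleGraph.fromEdgeSet {s(i, j), s(j, k), s(i, k)}

/-- Graphs obtained from one triangle by successively adding triangles. A new triangle either shares
an edge with the current graph and brings one new vertex and two new edges, or it has all three
vertices and two of its edges in the current graph and brings one new edge. -/
inductive BuiltByTriangles {ι : Type*} : SimpleGraph ι → Prop
  | single (i j k : ι) (hij : i ≠ j) (hjk : j ≠ k) (hik : i ≠ k) :
      BuiltByTriangles (triangleGraph i j k)
  | addVertex (G : SimpleGraph ι) (i j k : ι) (hG : BuiltByTriangles G) (hij : G.Adj i j)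
      (hk : ∀ l, ¬ G.Adj k l) : BuiltByTriangles (G ⊔ triangleGraph i j k)
  | addEdge (G : SimpleGraph ι) (i j k : ι) (hG : BuiltByTriangles G) (hij : G.Adj i j)
      (hjk : G.Adj j k) (hne : i ≠ k) (hik : ¬ G.Adj i k) :
      BuiltByTriangles (G ⊔ triangleGraph i j k)

namespace DiskPacking

variable {ι : Type*}

/-- The contact graph `Γ`: two different disks are joined iff they touch. -/
def contactGraph (P : DiskPacking ι) : SimpleGraph ι where
  Adj i j := i ≠ j ∧ dist (P.x i) (P.x j) = P.a i + P.a j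
  symm := ⟨fun i j h => ⟨h.1.symm, by rw [dist_comm, h.2, add_comm]⟩⟩
  loopless := ⟨fun _ h => h.1 rfl⟩

/-- The unit vector `q^{ij}` pointing from `x i` to `x j`. -/
noncomputable def q (P : DiskPacking ι) (i j : ι) : Plane :=
  ‖P.x j - P.x i‖⁻¹ • (P.x j - P.x i)

theorem q_swap (P : DiskPacking ι) (i j : ι) : P.q j i = -P.q i j := by
  unfold q
  rw [norm_sub_rev, ← smul_neg, neg_sub]

/-- The closed triangle (convex hull) spanned by the centers with index in `t`. -/
def hull (P : DiskPacking ι) (t : Finset ι) : Set Plane :=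
  convexHull ℝ (P.x '' (t : Set ι))

/-- A triangle (elementary cell) of `Γ`: three mutually touching disks such that no edge of `Γ`
enters the open triangle spanned by their centers. -/
def IsCell (P : DiskPacking ι) (t : Finset ι) : Prop :=
  P.contactGraph.IsNClique 3 t ∧
    ∀ i j, P.contactGraph.Adj i j →
      Disjoint (interior (P.hull t)) (segment ℝ (P.x i) (P.x j))

/-- The closed polygonal region filled by the triangles of `Γ`. -/
def region (P : DiskPacking ι) : Set Plane :=
  ⋃ t ∈ {t : Finset ι | P.IsCell t}, P.hull t

/-- `Γ` is a triangulation of the connected polygonal domain `Ω = interior P.region`: the edges of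
`Γ` cut `Ω` into triangles (the cells; distinct cells have disjoint interiors because no edge enters
an open cell), and all vertices and edges of `Γ` belong to these triangles. -/
structure IsTriangulation (P : DiskPacking ι) : Prop where
  connected : IsConnected (interior P.region)
  vertex_mem : ∀ i, ∃ t, P.IsCell t ∧ i ∈ t
  edge_mem : ∀ i j, P.contactGraph.Adj i j → ∃ t, P.IsCell t ∧ i ∈ t ∧ j ∈ t

/-- Boundary vertices are those lying on the boundary of the polygonal domain; all the others are
interior vertices. -/
def IsBoundary (P : DiskPacking ι) (i : ι) : Prop := P.x i ∈ frontier P.region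

/-- The boundary vertices. -/
abbrev BdryVertex (P : DiskPacking ι) : Type _ := {i : ι // P.IsBoundary i}

/-- The interior (free) vertices. -/
abbrev IntVertex (P : DiskPacking ι) : Type _ := {i : ι // ¬ P.IsBoundary i}

/-- The edges of the contact graph. -/
abbrev Edge (P : DiskPacking ι) : Type _ := {e : Sym2 ι // e ∈ P.contactGraph.edgeSet}

noncomputable instance instFintypeEdge [Fintype ι] (P : DiskPacking ι) : Fintype P.Edge :=
  Fintype.ofFinite _

/-- Cell-connectedness: every connected induced subgraph `G_X` on a set `X` of at least two interior
vertices is attached to the rest of `Γ` by a quadrilateral made of two adjacent triangles of `Γ`,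
with exactly two vertices in `X`. (Two triangles with four vertices in all share an edge.) -/
def IsCellConnected [DecidableEq ι] (P : DiskPacking ι) : Prop :=
  ∀ X : Set ι, (∀ i ∈ X, ¬ P.IsBoundary i) → X.Nontrivial →
    (P.contactGraph.induce X).Connected →
    ∃ i j k l : ι, i ∈ X ∧ j ∈ X ∧ k ∉ X ∧ l ∉ X ∧ i ≠ j ∧ k ≠ l ∧
      ∃ t t' : Finset ι, P.IsCell t ∧ P.IsCell t' ∧ t ∪ t' = {i, j, k, l}

/-- Regular triangulations. -/
structure IsRegularTriangulation [DecidableEq ι] (P : DiskPacking ι) : Prop where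
  triangulation : P.IsTriangulation
  built : BuiltByTriangles P.contactGraph
  two_boundary : ∀ i j, ¬ P.IsBoundary i → P.IsBoundary j → P.contactGraph.Adj i j →
    ∃ k, P.IsBoundary k ∧ k ≠ j ∧ P.contactGraph.Adj i k ∧
      LinearIndependent ℝ ![P.q i j, P.q i k]
  cellConnected : P.IsCellConnected

/-- Boundary data: the boundary particles are divided into `M` groups, every particle touching
another one of its own group, and group `m` undergoes the infinitesimal rigid displacement with
parameters `c m`, `α m`, `xs m`. -/
structure BoundaryMotion (P : DiskPacking ι) where
  M : ℕ
  group : P.BdryVertex → Fin M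
  contact_in_group : ∀ i : P.BdryVertex, ∃ j : P.BdryVertex,
    P.contactGraph.Adj i j ∧ group j = group i
  c : Fin M → Plane
  α : Fin M → ℝ
  xs : Fin M → Plane

/-- The prescribed boundary displacements `g i = c^m + α^m K (x^i - x^{⋆,m})`. -/
noncomputable def BoundaryMotion.g {P : DiskPacking ι} (B : P.BoundaryMotion) (i : P.BdryVertex) :
    Plane :=
  B.c (B.group i) + B.α (B.group i) • rotK (P.x i - B.xs (B.group i))

/-- The elongation `(u^j - u^i) · q^{ij}` of an edge; it does not depend on the orientation. -/
noncomputable def stretch (P : DiskPacking ι) (u : ι → Plane) : Sym2 ι → ℝ :=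
  Sym2.lift ⟨fun i j => inner ℝ (u j - u i) (P.q i j), fun i j => by
    change inner ℝ (u j - u i) (P.q i j) = inner ℝ (u i - u j) (P.q j i)
    rw [P.q_swap i j, inner_neg_right, ← inner_neg_left, neg_sub]⟩

/-- The rigidity matrix `R^r`, as a linear map from displacements of all vertices to edge vectors. -/
noncomputable def rigidity (P : DiskPacking ι) : (ι → Plane) →ₗ[ℝ] (P.Edge → ℝ) where
  toFun u e := P.stretch u e.1
  map_add' u v := by
    funext e
    obtain ⟨e, he⟩ := e
    induction e with
    | _ i j =>
      simp only [stretch, Sym2.lift_mk, Pi.add_apply]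
      rw [← inner_add_left]
      congr 1
      abel
  map_smul' r u := by
    funext e
    obtain ⟨e, he⟩ := e
    induction e with
    | _ i j =>
      simp only [stretch, Sym2.lift_mk, Pi.smul_apply, RingHom.id_apply, smul_eq_mul]
      rw [← smul_sub, real_inner_smul_left]

open Classical in
/-- Extension by zero of a displacement of the interior vertices. -/
noncomputable def extendInt (P : DiskPacking ι) : (P.IntVertex → Plane) →ₗ[ℝ] (ι → Plane) where
  toFun z i := if h : P.IsBoundary i then 0 else z ⟨i, h⟩
  map_add' z w := by
    funext i
    by_cases h : P.IsBoundary i <;> simp [h]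
  map_smul' r z := by
    funext i
    by_cases h : P.IsBoundary i <;> simp [h]

open Classical in
/-- Extension by zero of a displacement of the boundary vertices. -/
noncomputable def extendBdry (P : DiskPacking ι) (w : P.BdryVertex → Plane) : ι → Plane :=
  fun i => if h : P.IsBoundary i then w ⟨i, h⟩ else 0

/-- The block `R` of `R^r = [R | R^b]` that acts on the interior displacements. -/
noncomputable def R (P : DiskPacking ι) : (P.IntVertex → Plane) →ₗ[ℝ] (P.Edge → ℝ) :=
  P.rigidity ∘ₗ P.extendInt

namespace BoundaryMotion

variable {P : DiskPacking ι}

/-- The vector `a = R^b g`. -/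
noncomputable def aVec (B : P.BoundaryMotion) : P.Edge → ℝ :=
  P.rigidity (P.extendBdry B.g)

/-- Feasibility in the reduced problem: `R z + a ≥ 0`. -/
def Feasible (B : P.BoundaryMotion) (z : P.IntVertex → Plane) : Prop :=
  ∀ e, 0 ≤ P.R z e + B.aVec e

/-- The objective `F(z) = (1/2) d⁻³ |R z + a + dδ|²` of the reduced problem, for the pre-stress
vector `dδ`. -/
noncomputable def F [Fintype ι] (B : P.BoundaryMotion) (d : ℝ) (δ : P.Edge → ℝ)
    (z : P.IntVertex → Plane) : ℝ :=
  1 / 2 * (d ^ 3)⁻¹ * ∑ e, (P.R z e + B.aVec e + d * δ e) ^ 2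

/-- `z` is a minimizer of the reduced problem: minimize `F` subject to `R z + a ≥ 0`. -/
def IsMinimizer [Fintype ι] (B : P.BoundaryMotion) (d : ℝ) (δ : P.Edge → ℝ)
    (z : P.IntVertex → Plane) : Prop :=
  B.Feasible z ∧ ∀ z', B.Feasible z' → B.F d δ z ≤ B.F d δ z'

/-- `z` minimizes `F` subject to the boundary conditions only. -/
def IsUnconstrainedMinimizer [Fintype ι] (B : P.BoundaryMotion) (d : ℝ) (δ : P.Edge → ℝ)
    (z : P.IntVertex → Plane) : Prop :=
  ∀ z', B.F d δ z ≤ B.F d δ z'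

/-- The contact `i j` is an edge and is active (solid-like) at `z`. -/
def IsActive (B : P.BoundaryMotion) (z : P.IntVertex → Plane) (i j : ι) : Prop :=
  ∃ h : P.contactGraph.Adj i j, P.R z ⟨s(i, j), h⟩ + B.aVec ⟨s(i, j), h⟩ = 0

/-- Every interior vertex has two incident active edges with linearly independent directions. -/
def TwoSolidContacts (B : P.BoundaryMotion) (z : P.IntVertex → Plane) : Prop :=
  ∀ i : P.IntVertex, ∃ j k : ι, B.IsActive z i j ∧ B.IsActive z i k ∧
    LinearIndependent ℝ ![P.q i j, P.q i k]

/-- The reduced problem with pre-stress vector `dδ` has exactly one minimizer, and at that minimizer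
every interior vertex has two active edges with linearly independent directions. -/
def UniqueSolidMinimizer [Fintype ι] (B : P.BoundaryMotion) (d : ℝ) (δ : P.Edge → ℝ) : Prop :=
  ∃ z, B.IsMinimizer d δ z ∧ (∀ z', B.IsMinimizer d δ z' → z' = z) ∧ B.TwoSolidContacts z

/-- No gaps: boundary particles in contact are displaced so that the distance of their centers stays
at most `a_i + a_j + min_k a_k`. -/
def NoGaps (B : P.BoundaryMotion) : Prop :=
  ∀ i j : P.BdryVertex, P.contactGraph.Adj i j →
    ∀ k, dist (P.x i + B.g i) (P.x j + B.g j) ≤ P.a i + P.a j + P.a k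

end BoundaryMotion

end DiskPacking

end Granular

/-! The feasible set is a polyhedron, and up to the factor d⁻³/2 the objective is |Rz + a|² + 2d
δ·(Rz + a) plus a constant, so for large d the linear functional δ·Rz decides. If the polyhedron is
compact, it is the convex hull of its finitely many vertices. Almost every δ separates these, and
then for large d the vertex with the least δ·Rz is the only minimizer (`exists_vertex_minimizer`).
At a vertex of the polyhedron the active constraints have full rank, so no interior disk can be
moved alone without changing the length of an active edge to first order. Hence its active edges
span the plane (`twoSolidContacts_of_mem_polyVertices`).

Compactness reduces to: R w ≥ 0 implies w = 0 (`eq_zero_of_R_nonneg`). The reason is a positive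
stress. Give the three sides of each cell a tension equal to its inradius r. The incircle touches
the sides at the contact points of the disks, so the force of the cell at its corner i is r(q_ij +
q_ik) = a_i J(q_ij - q_ik), with J the quarter turn (`inradius_smul_add`). Around an interior vertex
these differences cancel, because every edge has exactly one cell on each side. Pairing this stress
with a displacement that vanishes on the boundary gives a positive combination of stretches equal to
zero, so nonnegative stretches all vanish. Since the graph is built from triangles, the displacement
is then an infinitesimal rigid motion, and it is zero because it fixes two touching boundary disks.
-/

namespace Granular

open MeasureTheory

/-! ### Polyhedra and least squares with a large linear term -/

section Polyhedron

variable {E Z : Type*} [NormedAddCommGroup Z] [NormedSpace ℝ Z]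

/-- The polyhedron `A z + a ≥ 0`. -/
def polyhedron (A : Z →ₗ[ℝ] E → ℝ) (a : E → ℝ) : Set Z := {z | ∀ e, 0 ≤ A z e + a e}

/-- The points of the polyhedron `A z + a ≥ 0` at which the active constraints have full rank. -/
def polyVertices (A : Z →ₗ[ℝ] E → ℝ) (a : E → ℝ) : Set Z :=
  {z | z ∈ polyhedron A a ∧ ∀ w, (∀ e, A z e + a e = 0 → A w e = 0) → w = 0}

/-- A vertex is determined by its set of active constraints: the difference of two points with the
same active set is killed by all of them. -/
theorem finite_polyVertices [Finite E] (A : Z →ₗ[ℝ] E → ℝ) (a : E → ℝ) : (polyVertices A a).Finite := by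
  refine Set.Finite.of_finite_image (f := fun z => {e | A z e + a e = 0}) (Set.toFinite _) ?_
  intro z hz z' hz' heq
  have hsub : z - z' = 0 := hz.2 _ fun e he => by
    have he' : A z' e + a e = 0 := (Set.ext_iff.1 heq e).1 he
    rw [map_sub, Pi.sub_apply]
    linarith
  exact sub_eq_zero.1 hsub

theorem convex_polyhedron (A : Z →ₗ[ℝ] E → ℝ) (a : E → ℝ) : Convex ℝ (polyhedron A a) := by
  intro x hx y hy s t hs ht hst e
  have h : A (s • x + t • y) e + a e = s * (A x e + a e) + t * (A y e + a e) := by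
    simp only [map_add, map_smul, Pi.add_apply, Pi.smul_apply, smul_eq_mul]
    linear_combination (-(a e)) * hst
  rw [h]
  exact add_nonneg (mul_nonneg hs (hx e)) (mul_nonneg ht (hy e))

/-- Convexity of this set carries a strict inequality from the other vertices to every point of the
hull except `v`. -/
theorem convex_insert_lt (l : Z →ₗ[ℝ] ℝ) (v : Z) : Convex ℝ {z | z = v ∨ l v < l z} := by
  intro x hx y hy s t hs ht hst
  have hs' : s = 1 - t := by linarith
  rcases hs.eq_or_lt with rfl | hs0
  · obtain rfl : t = 1 := by linarith
    simpa using hy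
  rcases ht.eq_or_lt with rfl | ht0
  · obtain rfl : s = 1 := by linarith
    simpa using hx
  rcases hx with rfl | hx <;> rcases hy with rfl | hy
  · left
    rw [← add_smul, hst, one_smul]
  all_goals
    right
    simp only [map_add, map_smul, smul_eq_mul]
    subst hs'
  · nlinarith [mul_lt_mul_of_pos_left hy ht0]
  · nlinarith [mul_lt_mul_of_pos_left hx hs0]
  · nlinarith [mul_lt_mul_of_pos_left hy ht0, mul_lt_mul_of_pos_left hx hs0]

variable [FiniteDimensional ℝ Z]

theorem continuous_coord (A : Z →ₗ[ℝ] E → ℝ) (e : E) : Continuous fun z => A z e :=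
  (continuous_apply e).comp A.continuous_of_finiteDimensional

variable [Fintype E]

/-- The hypothesis says that the recession cone is trivial. The total violation `φ` is then positive
on the unit sphere, and being positively homogeneous it grows at least linearly, while on the
polyhedron it is at most `∑ |a e|`. -/
theorem isCompact_polyhedron (A : Z →ₗ[ℝ] E → ℝ) (a : E → ℝ)
    (h : ∀ w, (∀ e, 0 ≤ A w e) → w = 0) : IsCompact (polyhedron A a) := by
  have : ProperSpace Z := FiniteDimensional.proper_real Z
  have hclosed : IsClosed (polyhedron A a) := by
    have : polyhedron A a = ⋂ e, {z | 0 ≤ A z e + a e} := by ext; simp [polyhedron]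
    rw [this]
    exact isClosed_iInter fun e =>
      isClosed_le continuous_const ((continuous_coord A e).add continuous_const)
  refine Metric.isCompact_of_isClosed_isBounded hclosed ?_
  let φ : Z → ℝ := fun w => ∑ e, max (-(A w e)) 0
  have hφ : Continuous φ :=
    continuous_finsetSum _ fun e _ => (continuous_coord A e).neg.max continuous_const
  rcases subsingleton_or_nontrivial Z with hZ | hZ
  · exact (Set.toFinite _).isBounded
  obtain ⟨w₀, hw₀, hmin⟩ := (isCompact_sphere (0 : Z) 1).exists_isMinOn
    (NormedSpace.sphere_nonempty.2 zero_le_one) hφ.continuousOn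
  have hpos : 0 < φ w₀ := by
    have h0 : 0 ≤ φ w₀ := Finset.sum_nonneg fun e _ => le_max_right _ _
    refine lt_of_le_of_ne h0 fun heq => ?_
    have := (Finset.sum_eq_zero_iff_of_nonneg
      (fun e _ => le_max_right (-(A w₀ e)) 0)).1 heq.symm
    have hw : w₀ = 0 := h w₀ fun e => by
      have h1 := this e (Finset.mem_univ e)
      have h2 := le_max_left (-(A w₀ e)) 0
      linarith
    simp [hw] at hw₀
  refine (Metric.isBounded_closedBall (x := (0 : Z)) (r := (∑ e, |a e|) / φ w₀)).subset ?_
  intro z hz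
  rw [mem_closedBall_zero_iff, le_div_iff₀ hpos]
  rcases eq_or_ne z 0 with rfl | hz0
  · simpa using Finset.sum_nonneg fun e _ => abs_nonneg (a e)
  have hn : 0 < ‖z‖ := norm_pos_iff.2 hz0
  have h1 : φ w₀ ≤ φ (‖z‖⁻¹ • z) := by
    apply hmin
    simp [norm_smul, hn.ne']
  have h2 : ‖z‖ * φ (‖z‖⁻¹ • z) = φ z := by
    simp only [φ, Finset.mul_sum]
    refine Finset.sum_congr rfl fun e _ => ?_
    rw [mul_max_of_nonneg _ _ hn.le, map_smul, Pi.smul_apply, smul_eq_mul, mul_zero]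
    congr 1
    field_simp
  have h3 : φ z ≤ ∑ e, |a e| := by
    refine Finset.sum_le_sum fun e _ => max_le ?_ (abs_nonneg _)
    have := hz e
    have := le_abs_self (a e)
    linarith
  nlinarith [mul_le_mul_of_nonneg_left h1 hn.le]

-- If `w` is killed by all active constraints, then `z ± t w` stays feasible for small `t > 0`, the
-- inactive constraints having slack. Extremality forces `w = 0`.
open Filter Topology in
theorem extremePoints_polyhedron_subset (A : Z →ₗ[ℝ] E → ℝ) (a : E → ℝ) :
    (polyhedron A a).extremePoints ℝ ⊆ polyVertices A a := by
  intro z hz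
  refine ⟨hz.1, fun w hw => ?_⟩
  have hev : ∀ v : Z, (∀ e, A z e + a e = 0 → A v e = 0) →
      ∀ᶠ t : ℝ in 𝓝[>] 0, z + t • v ∈ polyhedron A a := by
    intro v hv
    refine eventually_all.2 fun e => ?_
    rcases (hz.1 e).eq_or_lt with h0 | h0
    · refine Eventually.of_forall fun t => ?_
      simp only [map_add, map_smul, Pi.add_apply, Pi.smul_apply, smul_eq_mul, hv e h0.symm]
      linarith
    · have hc : Continuous fun t : ℝ => A (z + t • v) e + a e :=
        ((continuous_coord A e).comp (by fun_prop)).add continuous_const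
      have : Tendsto (fun t : ℝ => A (z + t • v) e + a e) (𝓝[>] 0) (𝓝 (A z e + a e)) := by
        simpa using (hc.tendsto 0).mono_left nhdsWithin_le_nhds
      exact (this.eventually (lt_mem_nhds h0)).mono fun t ht => ht.le
  obtain ⟨t, ⟨h1, h2⟩, ht⟩ := (((hev w hw).and (hev (-w) fun e he => by simp [hw e he])).and
    self_mem_nhdsWithin).exists
  have ht : (0 : ℝ) < t := ht
  have hmem : z ∈ openSegment ℝ (z + t • w) (z + t • -w) :=
    ⟨1 / 2, 1 / 2, by norm_num, by norm_num, by norm_num, by module⟩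
  have h3 := hz.2 h1 h2 hmem
  have h4 : t • w = 0 := by simpa using h3
  exact (smul_eq_zero.1 h4).resolve_left ht.ne'

/-- Krein–Milman; the closure is harmless because the hull of a finite set is closed. -/
theorem polyhedron_subset_convexHull (A : Z →ₗ[ℝ] E → ℝ) (a : E → ℝ)
    (h : ∀ w, (∀ e, 0 ≤ A w e) → w = 0) :
    polyhedron A a ⊆ convexHull ℝ (polyVertices A a) := by
  rw [← closure_convexHull_extremePoints (isCompact_polyhedron A a h) (convex_polyhedron A a)]
  exact closure_minimal (convexHull_mono (extremePoints_polyhedron_subset A a))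
    ((finite_polyVertices A a).isClosed_convexHull (𝕜 := ℝ))

theorem ae_linear_ne {x : E → ℝ} (hx : x ≠ 0) : ∀ᵐ δ : E → ℝ, ∑ e, δ e * x e ≠ 0 := by
  classical
  let l : (E → ℝ) →ₗ[ℝ] ℝ := ∑ e, x e • LinearMap.proj e
  have hl : ∀ δ, l δ = ∑ e, δ e * x e := fun δ => by
    simp [l, LinearMap.sum_apply, mul_comm]
  have hker : LinearMap.ker l ≠ ⊤ := by
    intro htop
    apply hx
    funext e
    have h1 : Pi.single e (1 : ℝ) ∈ LinearMap.ker l := htop ▸ Submodule.mem_top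
    rw [LinearMap.mem_ker, hl] at h1
    simpa [Pi.single_apply] using h1
  have := Measure.addHaar_submodule (volume : Measure (E → ℝ)) _ hker
  rw [ae_iff]
  convert this using 2
  ext δ
  simp [hl]

omit [FiniteDimensional ℝ Z] in
/-- For almost every `δ`, the linear functional `δ` separates the images of the vertices. -/
theorem ae_separates (A : Z →ₗ[ℝ] E → ℝ) (a : E → ℝ) (hinj : ∀ w, A w = 0 → w = 0) :
    ∀ᵐ δ : E → ℝ, ∀ v ∈ polyVertices A a, ∀ v' ∈ polyVertices A a, v ≠ v' →
      ∑ e, δ e * A v e ≠ ∑ e, δ e * A v' e := by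
  have hc := (finite_polyVertices A a).countable
  refine (ae_ball_iff hc).2 fun v _ => (ae_ball_iff hc).2 fun v' _ => ?_
  by_cases hne : v = v'
  · exact Filter.Eventually.of_forall fun _ h => absurd hne h
  have hx : A (v - v') ≠ 0 := fun h => hne (sub_eq_zero.1 (hinj _ h))
  filter_upwards [ae_linear_ne hx] with δ hδ _ heq
  apply hδ
  simp only [map_sub, Pi.sub_apply, mul_sub, Finset.sum_sub_distrib, heq, sub_self]

open Filter Topology in
/-- If `δ` separates the vertices of the polyhedron `A z + a ≥ 0`, then for large `d` a single vertex
is the unique minimizer of `|A z + a + d δ|²` on it. -/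
theorem exists_vertex_minimizer (A : Z →ₗ[ℝ] E → ℝ) (a : E → ℝ)
    (h : ∀ w, (∀ e, 0 ≤ A w e) → w = 0) (hne : (polyhedron A a).Nonempty) (δ : E → ℝ)
    (hδ : ∀ v ∈ polyVertices A a, ∀ v' ∈ polyVertices A a, v ≠ v' →
      ∑ e, δ e * A v e ≠ ∑ e, δ e * A v' e) :
    ∃ v ∈ polyVertices A a, ∃ D : ℝ, 0 < D ∧ ∀ d, D < d → ∀ z ∈ polyhedron A a, z ≠ v →
      ∑ e, (A v e + a e + d * δ e) ^ 2 < ∑ e, (A z e + a e + d * δ e) ^ 2 := by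
  have hfin := finite_polyVertices A a
  have hsub := polyhedron_subset_convexHull A a h
  have hVne : (polyVertices A a).Nonempty := by
    obtain ⟨z, hz⟩ := hne
    exact convexHull_nonempty_iff.1 ⟨z, hsub hz⟩
  obtain ⟨v, hv, hmin⟩ := hfin.exists_minimalFor (fun v => ∑ e, δ e * A v e) _ hVne
  have hlt : ∀ v' ∈ polyVertices A a, v' ≠ v → 0 < ∑ e, δ e * A (v' - v) e := by
    intro v' hv' hne'
    have h1 := hδ v' hv' v hv hne'
    have h2 : ∑ e, δ e * A v e ≤ ∑ e, δ e * A v' e := by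
      rcases le_total (∑ e, δ e * A v e) (∑ e, δ e * A v' e) with h | h
      · exact h
      · exact hmin hv' h
    simp only [map_sub, Pi.sub_apply, mul_sub, Finset.sum_sub_distrib]
    exact sub_pos.2 (lt_of_le_of_ne h2 h1.symm)
  -- Half the derivative of the objective at `v` towards `v'` is affine in `d` with positive slope.
  -- Finitely many `v'` allow a common threshold.
  have hev : ∀ᶠ d : ℝ in atTop, ∀ v' ∈ polyVertices A a, v' ≠ v →
      0 < ∑ e, (A v e + a e + d * δ e) * A (v' - v) e := by
    refine (eventually_all_finite hfin).2 fun v' hv' => ?_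
    by_cases hne' : v' = v
    · exact Eventually.of_forall fun _ h => absurd hne' h
    have ht : Tendsto (fun d : ℝ => ∑ e, (A v e + a e) * A (v' - v) e +
        d * ∑ e, δ e * A (v' - v) e) atTop atTop :=
      tendsto_atTop_add_const_left _ _ (tendsto_id.atTop_mul_const (hlt v' hv' hne'))
    filter_upwards [ht.eventually_gt_atTop 0] with d hd _
    refine hd.trans_eq ?_
    rw [Finset.mul_sum, ← Finset.sum_add_distrib]
    exact Finset.sum_congr rfl fun e _ => by ring
  obtain ⟨D, hD⟩ := eventually_atTop.1 hev
  refine ⟨v, hv, max D 1, by positivity, fun d hd z hz hzv => ?_⟩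
  have hd' := hD d ((le_max_left _ _).trans hd.le)
  let l : Z →ₗ[ℝ] ℝ := ∑ e, (A v e + a e + d * δ e) • (LinearMap.proj e ∘ₗ A)
  have hl : ∀ w, l w = ∑ e, (A v e + a e + d * δ e) * A w e := fun w => by
    simp [l, LinearMap.sum_apply]
  have hmem : z ∈ {z | z = v ∨ l v < l z} := by
    refine convexHull_min ?_ (convex_insert_lt l v) (hsub hz)
    intro v' hv'
    by_cases hne' : v' = v
    · exact Or.inl hne'
    · have := hd' v' hv' hne'
      rw [← hl, map_sub] at this
      exact Or.inr (sub_pos.1 this)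
  have hpos : 0 < l (z - v) := by
    rw [map_sub]
    exact sub_pos.2 (hmem.resolve_left hzv)
  rw [hl] at hpos
  have hsq : 0 ≤ ∑ e, A (z - v) e ^ 2 := Finset.sum_nonneg fun e _ => sq_nonneg _
  -- Exact second-order expansion at `v`: the linear term is positive and the remainder is a sum of
  -- squares.
  have : ∑ e, (A z e + a e + d * δ e) ^ 2 = ∑ e, (A v e + a e + d * δ e) ^ 2 +
      2 * ∑ e, (A v e + a e + d * δ e) * A (z - v) e + ∑ e, A (z - v) e ^ 2 := by
    rw [Finset.mul_sum, ← Finset.sum_add_distrib, ← Finset.sum_add_distrib]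
    refine Finset.sum_congr rfl fun e _ => ?_
    rw [map_sub, Pi.sub_apply]
    ring
  linarith

end Polyhedron

/-! ### Plane vectors and determinants -/

/-- The determinant of two plane vectors. -/
def cross (u v : Plane) : ℝ := u 0 * v 1 - u 1 * v 0

/-- Counterclockwise rotation by `π / 2`. -/
noncomputable def rotJ (v : Plane) : Plane := !₂[-v 1, v 0]

theorem plane_inner (u v : Plane) : inner ℝ u v = u 0 * v 0 + u 1 * v 1 := by
  simp [PiLp.inner_apply, Fin.sum_univ_two, mul_comm]

theorem plane_norm_sq (u : Plane) : ‖u‖ ^ 2 = u 0 ^ 2 + u 1 ^ 2 := by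
  simp [EuclideanSpace.norm_sq_eq, Fin.sum_univ_two]

@[ext]
theorem plane_ext {u v : Plane} (h0 : u 0 = v 0) (h1 : u 1 = v 1) : u = v := by
  ext n
  fin_cases n <;> assumption

theorem cross_smul_eq (u v w : Plane) :
    cross v w • u = cross u w • v + cross v u • w := by
  apply plane_ext <;> simp [cross] <;> ring

theorem eq_add_of_cross_ne_zero {v w : Plane} (h : cross v w ≠ 0) (u : Plane) :
    u = (cross u w / cross v w) • v + (cross v u / cross v w) • w := by
  have := congrArg (fun x => (cross v w)⁻¹ • x) (cross_smul_eq u v w)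
  simp only [smul_smul, smul_add, inv_mul_cancel₀ h, one_smul] at this
  simpa only [div_eq_inv_mul] using this

theorem cross_swap (u v : Plane) : cross v u = -cross u v := by
  unfold cross
  ring

theorem cross_smul_left (c : ℝ) (u v : Plane) : cross (c • u) v = c * cross u v := by
  simp [cross]
  ring

theorem cross_smul_right (c : ℝ) (u v : Plane) : cross u (c • v) = c * cross u v := by
  simp [cross]
  ring

theorem cross_add_left (u u' v : Plane) : cross (u + u') v = cross u v + cross u' v := by
  simp [cross]
  ring

theorem cross_add_right (u v v' : Plane) : cross u (v + v') = cross u v + cross u v' := by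
  simp [cross]
  ring

theorem cross_self (u : Plane) : cross u u = 0 := by
  unfold cross
  ring

theorem cross_rotJ_self (u : Plane) : cross u (rotJ u) = ‖u‖ ^ 2 := by
  rw [plane_norm_sq]
  simp [cross, rotJ]
  ring

theorem continuous_cross_left (v : Plane) : Continuous fun u => cross u v := by
  unfold cross
  fun_prop

theorem continuous_cross_right (v : Plane) : Continuous fun u => cross v u := by
  unfold cross
  fun_prop

/-! ### Triangles of touching disks and the cells around an interior vertex -/

namespace DiskPacking

variable {ι : Type*} (P : DiskPacking ι)

/-- Twice the signed area of the triangle of centers `i j k`. -/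
def area2 (i j k : ι) : ℝ := cross (P.x j - P.x i) (P.x k - P.x i)

theorem area2_rotate (i j k : ι) : P.area2 j k i = P.area2 i j k := by
  simp [area2, cross]
  ring

theorem area2_swap (i j k : ι) : P.area2 i k j = -P.area2 i j k := cross_swap _ _

theorem area2_swap_left (i j k : ι) : P.area2 j i k = -P.area2 i j k := by
  simp [area2, cross]
  ring

variable {P}

theorem norm_sub_of_adj {i j : ι} (h : P.contactGraph.Adj i j) :
    ‖P.x j - P.x i‖ = P.a i + P.a j := by
  rw [← dist_eq_norm, dist_comm]
  exact h.2

theorem norm_sq_of_adj {i j : ι} (h : P.contactGraph.Adj i j) :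
    (P.x j 0 - P.x i 0) ^ 2 + (P.x j 1 - P.x i 1) ^ 2 = (P.a i + P.a j) ^ 2 := by
  rw [← norm_sub_of_adj h, plane_norm_sq]
  simp

theorem q_of_adj {i j : ι} (h : P.contactGraph.Adj i j) :
    P.q i j = (P.a i + P.a j)⁻¹ • (P.x j - P.x i) := by
  rw [q, norm_sub_of_adj h]

/-- Heron's formula: the semiperimeter is the sum of the three radii, and its excesses over the
sides are the radii themselves. -/
theorem area2_ne_zero {i j k : ι} (hij : P.contactGraph.Adj i j) (hik : P.contactGraph.Adj i k)
    (hjk : P.contactGraph.Adj j k) : P.area2 i j k ≠ 0 := by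
  have h1 := norm_sq_of_adj hij
  have h2 := norm_sq_of_adj hik
  have h3 := norm_sq_of_adj hjk
  have hi := P.radius_pos i
  have hj := P.radius_pos j
  have hk := P.radius_pos k
  have h : P.area2 i j k ^ 2 =
      4 * P.a i * P.a j * P.a k * (P.a i + P.a j + P.a k) := by
    simp only [area2, cross, PiLp.sub_apply]
    generalize P.x i 0 = x0 at *
    generalize P.x i 1 = x1 at *
    obtain ⟨u0, hu0⟩ : ∃ u0, u0 = P.x j 0 - x0 := ⟨_, rfl⟩
    obtain ⟨u1, hu1⟩ : ∃ u1, u1 = P.x j 1 - x1 := ⟨_, rfl⟩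
    obtain ⟨v0, hv0⟩ : ∃ v0, v0 = P.x k 0 - x0 := ⟨_, rfl⟩
    obtain ⟨v1, hv1⟩ : ∃ v1, v1 = P.x k 1 - x1 := ⟨_, rfl⟩
    have h3' : (v0 - u0) ^ 2 + (v1 - u1) ^ 2 = (P.a j + P.a k) ^ 2 := by
      rw [← h3, hv0, hv1, hu0, hu1]
      ring
    rw [← hu0, ← hu1] at h1 ⊢
    rw [← hv0, ← hv1] at h2 ⊢
    have hw : u0 * v0 + u1 * v1 =
        ((P.a i + P.a j) ^ 2 + (P.a i + P.a k) ^ 2 - (P.a j + P.a k) ^ 2) / 2 := by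
      linear_combination (h1 + h2 - h3') / 2
    have : (u0 * v1 - u1 * v0) ^ 2 =
        (u0 ^ 2 + u1 ^ 2) * (v0 ^ 2 + v1 ^ 2) - (u0 * v0 + u1 * v1) ^ 2 := by ring
    rw [this, h1, h2, hw]
    ring
  intro h0
  rw [h0] at h
  have : 0 < 4 * P.a i * P.a j * P.a k * (P.a i + P.a j + P.a k) := by positivity
  nlinarith

/-- Two disks touching disk `i` in the same direction have centers at distance |a_j - a_l| < a_j +
a_l, so they would overlap. -/
theorem eq_of_same_ray {i j l : ι} (hj : P.contactGraph.Adj i j) (hl : P.contactGraph.Adj i l)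
    {c : ℝ} (hc : 0 ≤ c) (h : P.x j - P.x i = c • (P.x l - P.x i)) : j = l := by
  by_contra hne
  have h1 := norm_sub_of_adj hj
  have h2 := norm_sub_of_adj hl
  have h3 := P.nonoverlapping j l hne
  rw [h, norm_smul, h2, Real.norm_of_nonneg hc] at h1
  have h4 : P.x j - P.x l = (c - 1) • (P.x l - P.x i) := by
    rw [sub_smul, one_smul, ← h]
    abel
  rw [dist_eq_norm, h4, norm_smul, h2, Real.norm_eq_abs] at h3
  have hi := P.radius_pos i
  have hj := P.radius_pos j
  have hl := P.radius_pos l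
  rcases abs_cases (c - 1) with ⟨h5, _⟩ | ⟨h5, _⟩ <;> rw [h5] at h3 <;> nlinarith

theorem notMem_segment {i j k : ι} (hij : i ≠ j) (hik : i ≠ k)
    (hjk : P.contactGraph.Adj j k) : P.x i ∉ segment ℝ (P.x j) (P.x k) := by
  intro h
  have h1 := dist_add_dist_of_mem_segment h
  have h2 := P.nonoverlapping i j hij
  have h3 := P.nonoverlapping i k hik
  rw [hjk.2, dist_comm] at h1
  have := P.radius_pos i
  linarith

theorem hull_subset_region {t : Finset ι} (ht : P.IsCell t) : P.hull t ⊆ P.region :=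
  Set.subset_biUnion_of_mem (u := fun t => P.hull t) ht

variable [DecidableEq ι]

theorem hull_eq (i j k : ι) : P.hull {i, j, k} = convexHull ℝ {P.x i, P.x j, P.x k} := by
  simp [hull, Set.image_insert_eq]

theorem exists_of_mem_hull {i j k : ι} {y : Plane} (hy : y ∈ P.hull {i, j, k}) :
    ∃ α β : ℝ, 0 ≤ α ∧ 0 ≤ β ∧ α + β ≤ 1 ∧
      y - P.x i = α • (P.x j - P.x i) + β • (P.x k - P.x i) := by
  rw [hull_eq, convexHull_insert (by simp), convexHull_pair] at hy
  simp only [convexJoin_singleton_left, Set.mem_iUnion] at hy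
  obtain ⟨z, ⟨s, t, hs, ht, hst, rfl⟩, ⟨s', t', hs', ht', hst', rfl⟩⟩ := hy
  refine ⟨t' * s, t' * t, by positivity, by positivity, by nlinarith, ?_⟩
  have h1 : s' = 1 - t' * s - t' * t := by linear_combination hst' + t' * hst
  rw [h1]
  module

theorem mem_interior_hull {i j k : ι} (hD : P.area2 i j k ≠ 0) {y : Plane} {α β : ℝ}
    (hα : 0 < α) (hβ : 0 < β) (hαβ : α + β < 1)
    (hy : y - P.x i = α • (P.x j - P.x i) + β • (P.x k - P.x i)) :
    y ∈ interior (P.hull {i, j, k}) := by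
  -- Barycentric coordinates by Cramer's rule; they are continuous, so strict inequalities on them
  -- define an open subset of the hull.
  let f : Plane → ℝ := fun y => cross (y - P.x i) (P.x k - P.x i) / P.area2 i j k
  let g : Plane → ℝ := fun y => cross (P.x j - P.x i) (y - P.x i) / P.area2 i j k
  have hf : Continuous f :=
    ((continuous_cross_left _).comp (continuous_id.sub continuous_const)).div_const _
  have hg : Continuous g :=
    ((continuous_cross_right _).comp (continuous_id.sub continuous_const)).div_const _
  refine mem_interior.2 ⟨{y | 0 < f y ∧ 0 < g y ∧ f y + g y < 1}, ?_, ?_, ?_⟩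
  · rintro z ⟨h1, h2, h3⟩
    have hz := eq_add_of_cross_ne_zero hD (z - P.x i)
    have hz' : z = (1 - f z - g z) • P.x i + f z • P.x j + g z • P.x k := by
      have hz2 : z - P.x i = f z • (P.x j - P.x i) + g z • (P.x k - P.x i) := hz
      rw [← sub_eq_zero] at hz2 ⊢
      rw [← hz2]
      module
    have hconv := convex_convexHull ℝ ({P.x i, P.x j, P.x k} : Set Plane)
    rw [hull_eq, hz']
    have hmem : ∀ p ∈ ({P.x i, P.x j, P.x k} : Set Plane),
        p ∈ convexHull ℝ ({P.x i, P.x j, P.x k} : Set Plane) := fun p hp => subset_convexHull ℝ _ hp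
    have := hconv.sum_mem (t := Finset.univ) (w := ![1 - f z - g z, f z, g z])
      (z := ![P.x i, P.x j, P.x k])
      (by
        intro n _
        fin_cases n
        · change 0 ≤ 1 - f z - g z
          linarith
        · exact h1.le
        · exact h2.le)
      (by
        simp only [Fin.sum_univ_three, Matrix.cons_val]
        ring)
      (by
        intro n _
        fin_cases n <;> exact hmem _ (by simp))
    simpa [Fin.sum_univ_three] using this
  · exact (isOpen_lt continuous_const hf).inter ((isOpen_lt continuous_const hg).inter
      (isOpen_lt (hf.add hg) continuous_const))
  · have h1 : f y = α := by
      simp only [f, hy, cross_add_left, cross_smul_left, cross_self]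
      rw [div_eq_iff hD, area2]
      ring
    have h2 : g y = β := by
      simp only [g, hy, cross_add_right, cross_smul_right, cross_self]
      rw [div_eq_iff hD, area2]
      ring
    refine ⟨h1 ▸ hα, h2 ▸ hβ, ?_⟩
    rw [h1, h2]
    exact hαβ

theorem IsCell.adj {i j k : ι} (h : P.IsCell {i, j, k}) :
    P.contactGraph.Adj i j ∧ P.contactGraph.Adj i k ∧ P.contactGraph.Adj j k :=
  SimpleGraph.is3Clique_triple_iff.1 h.1

theorem IsCell.area2_ne_zero {i j k : ι} (h : P.IsCell {i, j, k}) : P.area2 i j k ≠ 0 :=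
  DiskPacking.area2_ne_zero h.adj.1 h.adj.2.1 h.adj.2.2

theorem IsCell.rotate {i j k : ι} (h : P.IsCell {i, j, k}) : P.IsCell {j, k, i} := by
  convert h using 1
  ext
  simp
  tauto

theorem IsCell.swap {i j k : ι} (h : P.IsCell {i, j, k}) : P.IsCell {i, k, j} := by
  convert h using 1
  ext
  simp
  tauto

theorem IsCell.exists_eq {t : Finset ι} (h : P.IsCell t) {i : ι} (hi : i ∈ t) :
    ∃ j k, P.IsCell {i, j, k} ∧ t = {i, j, k} := by
  obtain ⟨a, b, c, -, -, -, rfl⟩ := SimpleGraph.is3Clique_iff.1 h.1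
  simp only [Finset.mem_insert, Finset.mem_singleton] at hi
  rcases hi with rfl | rfl | rfl
  · exact ⟨b, c, h, rfl⟩
  · refine ⟨c, a, h.rotate, ?_⟩
    ext
    simp
    tauto
  · refine ⟨a, b, h.rotate.rotate, ?_⟩
    ext
    simp
    tauto

theorem IsCell.exists_third {t : Finset ι} (h : P.IsCell t) {i j : ι} (hi : i ∈ t) (hj : j ∈ t)
    (hij : i ≠ j) : ∃ k, P.IsCell {i, j, k} := by
  obtain ⟨b, c, hc, rfl⟩ := h.exists_eq hi
  simp only [Finset.mem_insert, Finset.mem_singleton] at hj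
  rcases hj with rfl | rfl | rfl
  · exact absurd rfl hij
  · exact ⟨c, hc⟩
  · exact ⟨b, hc.swap⟩

/-- No edge at a vertex of a cell points strictly into the angle of the cell. -/
theorem IsCell.not_adj_inside {i j k m : ι} (h : P.IsCell {i, j, k})
    (hm : P.contactGraph.Adj i m) {α β : ℝ} (hα : 0 < α) (hβ : 0 < β)
    (he : P.x m - P.x i = α • (P.x j - P.x i) + β • (P.x k - P.x i)) : False := by
  have hs : 0 < α + β + 1 := by positivity
  -- Shrinking the edge by this factor makes the coordinates sum to less than 1, so the point lies
  -- in the open cell.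
  have h1 : P.x i + (α + β + 1)⁻¹ • (P.x m - P.x i) ∈ interior (P.hull {i, j, k}) := by
    refine mem_interior_hull h.area2_ne_zero (α := (α + β + 1)⁻¹ * α) (β := (α + β + 1)⁻¹ * β)
      (by positivity) (by positivity) ?_ ?_
    · rw [← mul_add, inv_mul_lt_iff₀ hs]
      linarith
    · rw [add_sub_cancel_left, he]
      module
  refine Set.disjoint_left.1 (h.2 i m hm) h1 ?_
  rw [segment_eq_image']
  exact ⟨(α + β + 1)⁻¹, ⟨by positivity, inv_le_one_of_one_le₀ (by linarith)⟩, rfl⟩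

/-- A center lying in a cell is one of its vertices. -/
theorem IsTriangulation.mem_of_mem_hull (hT : P.IsTriangulation) {t : Finset ι} (ht : P.IsCell t)
    {i : ι} (hi : P.x i ∈ P.hull t) : i ∈ t := by
  by_contra hit
  obtain ⟨a, b, c, hab, hac, hbc, rfl⟩ := SimpleGraph.is3Clique_iff.1 ht.1
  simp only [Finset.mem_insert, Finset.mem_singleton, not_or] at hit
  obtain ⟨hia, hib, hic⟩ := hit
  obtain ⟨α, β, hα, hβ, hαβ, he⟩ := exists_of_mem_hull hi
  rcases hα.eq_or_lt with rfl | hα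
  · refine notMem_segment hia hic hac ?_
    rw [segment_eq_image']
    refine ⟨β, ⟨hβ, by linarith⟩, ?_⟩
    change P.x a + β • (P.x c - P.x a) = P.x i
    rw [zero_smul, zero_add] at he
    rw [← he]
    abel
  rcases hβ.eq_or_lt with rfl | hβ
  · refine notMem_segment hia hib hab ?_
    rw [segment_eq_image']
    refine ⟨α, ⟨hα.le, by linarith⟩, ?_⟩
    change P.x a + α • (P.x b - P.x a) = P.x i
    rw [zero_smul, add_zero] at he
    rw [← he]
    abel
  rcases hαβ.eq_or_lt with h1 | h1
  · refine notMem_segment hib hic hbc ?_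
    refine ⟨α, β, hα.le, hβ.le, h1, ?_⟩
    have h2 : P.x i = (P.x i - P.x a) + P.x a := by abel
    rw [h2, he]
    obtain rfl : β = 1 - α := by linarith
    module
  · have h2 := mem_interior_hull ht.area2_ne_zero hα hβ h1 he
    -- Every center is the end of some edge, and that edge would meet the open cell.
    obtain ⟨s, hs, his⟩ := hT.vertex_mem i
    obtain ⟨j, k, hs, -⟩ := hs.exists_eq his
    exact Set.disjoint_left.1 (ht.2 i j hs.adj.1) h2 (left_mem_segment _ _ _)

omit [DecidableEq ι] in
theorem IsTriangulation.mem_region (hT : P.IsTriangulation) (i : ι) : P.x i ∈ P.region := by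
  obtain ⟨t, ht, hit⟩ := hT.vertex_mem i
  exact hull_subset_region ht (subset_convexHull ℝ _ (Set.mem_image_of_mem _ hit))

omit [DecidableEq ι] in
theorem IsTriangulation.mem_interior (hT : P.IsTriangulation) {i : ι} (hi : ¬ P.IsBoundary i) :
    P.x i ∈ interior P.region := by
  by_contra h
  exact hi ⟨subset_closure (hT.mem_region i), h⟩

open Filter Topology in
theorem nonneg_of_frequently {f : ℝ → ℝ} (hf : Continuous f)
    (h : ∃ᶠ t in 𝓝[>] (0 : ℝ), 0 ≤ f t) : 0 ≤ f 0 := by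
  by_contra hlt
  have : ∀ᶠ t in 𝓝[>] (0 : ℝ), f t < 0 :=
    ((hf.tendsto 0).mono_left nhdsWithin_le_nhds).eventually (gt_mem_nhds (not_le.1 hlt))
  exact h (this.mono fun t ht => not_le.2 ht)

open Filter Topology in
/-- At an interior vertex every edge has a cell on each side. -/
theorem IsTriangulation.exists_cell_side [Finite ι] (hT : P.IsTriangulation) {i j : ι}
    (hi : ¬ P.IsBoundary i) (hij : P.contactGraph.Adj i j) {σ : ℝ} (hσ : σ ≠ 0) :
    ∃ k, P.IsCell {i, j, k} ∧ 0 < σ * P.area2 i j k := by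
  obtain ⟨v, hv⟩ : ∃ v, v = P.x j - P.x i := ⟨_, rfl⟩
  obtain ⟨n, hn⟩ : ∃ n, n = σ • rotJ v := ⟨_, rfl⟩
  have hvn : cross v n = σ * ‖v‖ ^ 2 := by rw [hn, cross_smul_right, cross_rotJ_self]
  have hvpos : 0 < ‖v‖ := by
    rw [hv, norm_sub_of_adj hij]
    exact add_pos (P.radius_pos i) (P.radius_pos j)
  -- A curve that leaves `x i` tangentially to the edge and bends to the side chosen by `σ`. Its
  -- first-order term finds a cell at the edge, its second-order term tells on which side that cell
  -- lies.
  let y : ℝ → Plane := fun t => P.x i + t • (v + t • n)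
  have hyc : Continuous y := by fun_prop
  have hy0 : y 0 = P.x i := by simp [y]
  have hyt : Tendsto y (𝓝[>] 0) (𝓝 (P.x i)) := by
    have := hyc.tendsto 0
    rw [hy0] at this
    exact this.mono_left nhdsWithin_le_nhds
  have hreg : ∀ᶠ t in 𝓝[>] (0 : ℝ), y t ∈ P.region :=
    hyt.eventually (mem_interior_iff_mem_nhds.1 (hT.mem_interior hi))
  -- There are finitely many cells, so one of them contains `y t` for arbitrarily small `t > 0`.
  obtain ⟨T, hTc, hfr⟩ : ∃ T, P.IsCell T ∧ ∃ᶠ t in 𝓝[>] (0 : ℝ), y t ∈ P.hull T := by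
    by_contra! hcon
    have h1 : ∀ᶠ t in 𝓝[>] (0 : ℝ), ∀ T : Finset ι, P.IsCell T → y t ∉ P.hull T := by
      refine eventually_all.2 fun T => ?_
      by_cases hc : P.IsCell T
      · exact (hcon T hc).mono fun t ht _ => ht
      · exact Eventually.of_forall fun _ h => absurd h hc
    obtain ⟨t, ht1, ht2⟩ := (hreg.and h1).exists
    obtain ⟨T, hTc, hTm⟩ := Set.mem_iUnion₂.1 ht1
    exact ht2 T hTc hTm
  have hiT : i ∈ T := by
    refine hT.mem_of_mem_hull hTc ?_
    have hcl : IsClosed (P.hull T) :=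
      (T.finite_toSet.image P.x).isClosed_convexHull (𝕜 := ℝ)
    by_contra hni
    exact hfr (hyt.eventually (hcl.isOpen_compl.mem_nhds hni))
  obtain ⟨k, l, hc, rfl⟩ := hTc.exists_eq hiT
  have hD := hc.area2_ne_zero
  let f : ℝ → ℝ := fun t => cross (v + t • n) (P.x l - P.x i) / P.area2 i k l
  let g : ℝ → ℝ := fun t => cross (P.x k - P.x i) (v + t • n) / P.area2 i k l
  have hfc : Continuous f := ((continuous_cross_left _).comp (by fun_prop)).div_const _
  have hgc : Continuous g := ((continuous_cross_right _).comp (by fun_prop)).div_const _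
  have hfg : ∃ᶠ t in 𝓝[>] (0 : ℝ), 0 < t ∧ 0 ≤ f t ∧ 0 ≤ g t := by
    refine (hfr.and_eventually self_mem_nhdsWithin).mono ?_
    rintro t ⟨ht, htpos⟩
    have htpos : 0 < t := htpos
    obtain ⟨α, β, hα, hβ, -, he⟩ := exists_of_mem_hull ht
    have he' : v + t • n = (t⁻¹ * α) • (P.x k - P.x i) + (t⁻¹ * β) • (P.x l - P.x i) := by
      rw [mul_smul, mul_smul, ← smul_add, ← he]
      simp [y, smul_smul, htpos.ne']
    have h1 : f t = t⁻¹ * α := by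
      change cross (v + t • n) (P.x l - P.x i) / _ = _
      rw [he', cross_add_left, cross_smul_left, cross_smul_left, cross_self]
      rw [div_eq_iff hD, area2]
      ring
    have h2 : g t = t⁻¹ * β := by
      change cross (P.x k - P.x i) (v + t • n) / _ = _
      rw [he', cross_add_right, cross_smul_right, cross_smul_right, cross_self]
      rw [div_eq_iff hD, area2]
      ring
    exact ⟨htpos, by rw [h1]; positivity, by rw [h2]; positivity⟩
  have hf0 : 0 ≤ f 0 := nonneg_of_frequently hfc (hfg.mono fun t h => h.2.1)
  have hg0 : 0 ≤ g 0 := nonneg_of_frequently hgc (hfg.mono fun t h => h.2.2)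
  obtain ⟨t, htpos, hft, hgt⟩ := hfg.exists
  have hv0 : v = f 0 • (P.x k - P.x i) + g 0 • (P.x l - P.x i) := by
    have := eq_add_of_cross_ne_zero hD v
    simpa [f, g, area2] using this
  have hσv : ∀ {D : ℝ}, D ≠ 0 → 0 ≤ t * (σ * ‖v‖ ^ 2) / D → 0 < σ * D := by
    intro D hD0 h
    have h1 : 0 ≤ (t * (σ * ‖v‖ ^ 2) / D) * D ^ 2 := mul_nonneg h (sq_nonneg D)
    have h2 : (t * (σ * ‖v‖ ^ 2) / D) * D ^ 2 = (t * ‖v‖ ^ 2) * (σ * D) := by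
      field_simp
    rw [h2] at h1
    exact lt_of_le_of_ne (nonneg_of_mul_nonneg_right h1 (by positivity))
      (mul_ne_zero hσ hD0).symm
  -- The limit direction `v` lies in the closed angle of the cell. It cannot be strictly inside,
  -- since no edge enters a cell, so it runs along one of the two sides.
  rcases hf0.eq_or_lt with hf0 | hf0
  · have hjl : j = l := by
      refine eq_of_same_ray hij hc.adj.2.1 hg0 ?_
      rw [← hv, hv0]
      simp [← hf0]
    subst hjl
    refine ⟨k, hc.swap, hσv hc.swap.area2_ne_zero ?_⟩
    convert hft using 1
    simp only [f, ← hv, cross_add_left, cross_self, cross_smul_left]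
    rw [cross_swap v n, hvn, P.area2_swap i k j, zero_add, mul_neg, neg_div, div_neg]
  rcases hg0.eq_or_lt with hg0 | hg0
  · have hjk : j = k := by
      refine eq_of_same_ray hij hc.adj.1 hf0.le ?_
      rw [← hv, hv0]
      simp [← hg0]
    subst hjk
    refine ⟨l, hc, hσv hD ?_⟩
    convert hgt using 1
    simp only [g, ← hv, cross_add_right, cross_self, cross_smul_right]
    rw [hvn, zero_add]
  · exact (hc.not_adj_inside hij hf0 hg0 (hv ▸ hv0)).elim

/-- An edge has at most one cell on each side. -/
theorem IsCell.unique_side {i j k k' : ι} (h : P.IsCell {i, j, k}) (h' : P.IsCell {i, j, k'})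
    {σ : ℝ} (hk : 0 < σ * P.area2 i j k) (hk' : 0 < σ * P.area2 i j k') : k = k' := by
  -- Up to exchanging `k` and `k'`, the direction of `k` lies in the angle between `j` and `k'`:
  -- strictly inside is impossible for an edge, and otherwise `k` and `k'` are on one ray.
  have key : ∀ {k k' : ι}, P.IsCell {i, j, k} → P.IsCell {i, j, k'} → 0 < σ * P.area2 i j k →
      0 < σ * P.area2 i j k' → 0 ≤ σ * P.area2 i k k' → k = k' := by
    intro k k' h h' hk hk' hs
    have hdec := eq_add_of_cross_ne_zero h'.area2_ne_zero (P.x k - P.x i)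
    have hσ : σ ≠ 0 := by
      rintro rfl
      simp at hk
    have h1 : 0 ≤ P.area2 i k k' / P.area2 i j k' := by
      rw [← mul_div_mul_left _ _ hσ]
      exact div_nonneg hs hk'.le
    have h2 : 0 < P.area2 i j k / P.area2 i j k' := by
      rw [← mul_div_mul_left _ _ hσ]
      exact div_pos hk hk'
    change _ = (P.area2 i k k' / P.area2 i j k') • _ + (P.area2 i j k / P.area2 i j k') • _ at hdec
    rcases h1.eq_or_lt with h1 | h1
    · rw [← h1, zero_smul, zero_add] at hdec
      exact eq_of_same_ray h.adj.2.1 h'.adj.2.1 h2.le hdec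
    · exact (h'.not_adj_inside h.adj.2.1 h1 h2 hdec).elim
  rcases le_total 0 (σ * P.area2 i k k') with hs | hs
  · exact key h h' hk hk' hs
  · refine (key h' h hk' hk ?_).symm
    rw [area2_swap]
    linarith

end DiskPacking

namespace DiskPacking

variable {ι : Type*} {P : DiskPacking ι}

theorem stretch_mk (u : ι → Plane) (i j : ι) :
    P.stretch u s(i, j) = inner ℝ (u j - u i) (P.q i j) := rfl

/-! ### The equilibrium stress given by the inradii -/

section Stress

variable [DecidableEq ι]

variable (P) in
/-- Positively oriented cells. -/
def PosCell (i j k : ι) : Prop := P.IsCell {i, j, k} ∧ 0 < P.area2 i j k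

theorem PosCell.rotate {i j k : ι} (h : P.PosCell i j k) : P.PosCell j k i :=
  ⟨h.1.rotate, by rw [area2_rotate]; exact h.2⟩

theorem posCell_rotate_iff {i j k : ι} : P.PosCell j k i ↔ P.PosCell i j k :=
  ⟨fun h => h.rotate.rotate, fun h => h.rotate⟩

variable (P) in
/-- The inradius of the triangle `i j k` (with a sign). -/
noncomputable def inradius (i j k : ι) : ℝ := P.area2 i j k / (2 * (P.a i + P.a j + P.a k))

theorem PosCell.inradius_pos {i j k : ι} (h : P.PosCell i j k) : 0 < P.inradius i j k := by
  have := P.radius_pos i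
  have := P.radius_pos j
  have := P.radius_pos k
  exact div_pos h.2 (by positivity)

omit [DecidableEq ι] in
theorem inradius_rotate (i j k : ι) : P.inradius j k i = P.inradius i j k := by
  rw [inradius, inradius, area2_rotate]
  congr 2
  ring

omit [DecidableEq ι] in
/-- The inradius times the sum of the two unit vectors along the sides at a vertex is the rotated
difference of the contact points on these sides. -/
theorem inradius_smul_add {i j k : ι} (hij : P.contactGraph.Adj i j)
    (hik : P.contactGraph.Adj i k) (hjk : P.contactGraph.Adj j k) :
    P.inradius i j k • (P.q i j + P.q i k) = P.a i • rotJ (P.q i j - P.q i k) := by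
  have h1 := norm_sq_of_adj hij
  have h2 := norm_sq_of_adj hik
  have h3 := norm_sq_of_adj hjk
  have hi := P.radius_pos i
  have hj := P.radius_pos j
  have hk := P.radius_pos k
  rw [q_of_adj hij, q_of_adj hik, inradius, area2]
  obtain ⟨u, hu⟩ : ∃ u, u = P.x j - P.x i := ⟨_, rfl⟩
  obtain ⟨v, hv⟩ : ∃ v, v = P.x k - P.x i := ⟨_, rfl⟩
  have h3' : (v 0 - u 0) ^ 2 + (v 1 - u 1) ^ 2 = (P.a j + P.a k) ^ 2 := by
    rw [← h3, hv, hu]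
    simp only [PiLp.sub_apply]
    ring
  have h1' : u 0 ^ 2 + u 1 ^ 2 = (P.a i + P.a j) ^ 2 := by simpa [hu] using h1
  have h2' : v 0 ^ 2 + v 1 ^ 2 = (P.a i + P.a k) ^ 2 := by simpa [hv] using h2
  rw [← hu, ← hv]
  -- The law of cosines: both sides equal |u||v|(1 + cos) for the angle at `i`.
  have hw : 2 * P.a i * (P.a i + P.a j + P.a k) =
      (P.a i + P.a j) * (P.a i + P.a k) + (u 0 * v 0 + u 1 * v 1) := by
    linear_combination (h3' - h1' - h2') / 2
  obtain ⟨A, hA⟩ : ∃ A, A = P.a i + P.a j := ⟨_, rfl⟩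
  obtain ⟨B, hB⟩ : ∃ B, B = P.a i + P.a k := ⟨_, rfl⟩
  obtain ⟨s, hs⟩ : ∃ s, s = P.a i + P.a j + P.a k := ⟨_, rfl⟩
  have hA0 : A ≠ 0 := by rw [hA]; positivity
  have hB0 : B ≠ 0 := by rw [hB]; positivity
  have hs0 : s ≠ 0 := by rw [hs]; positivity
  rw [← hs] at hw ⊢
  rw [← hA] at h1' hw ⊢
  rw [← hB] at h2' hw ⊢
  apply plane_ext <;>
    simp only [PiLp.smul_apply, PiLp.add_apply, PiLp.sub_apply, smul_eq_mul, cross, rotJ,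
      Matrix.cons_val_zero, Matrix.cons_val_one] <;> field_simp
  · linear_combination (v 1 * B) * h1' - (u 1 * A) * h2' - (A * v 1 - B * u 1) * hw
  · linear_combination (-(v 0 * B)) * h1' + (u 0 * A) * h2' - (B * u 0 - A * v 0) * hw

variable [Fintype ι]

-- Each edge at an interior vertex is the first side of exactly one positively oriented cell, and by
-- the next lemma the second side of exactly one. The two sums therefore cancel.
open Classical in
theorem sum_posCell_left (hT : P.IsTriangulation) {i : ι} (hi : ¬ P.IsBoundary i) (w : ι → ℝ) :
    ∑ j, ∑ k, (if P.PosCell i j k then w j else 0) =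
      ∑ j, if P.contactGraph.Adj i j then w j else 0 := by
  refine Finset.sum_congr rfl fun j _ => ?_
  by_cases hij : P.contactGraph.Adj i j
  · obtain ⟨k, hk, hpos⟩ := hT.exists_cell_side hi hij one_ne_zero
    rw [if_pos hij, Finset.sum_eq_single k, if_pos ⟨hk, by simpa using hpos⟩]
    · exact fun k' _ hne => if_neg fun h =>
        hne (h.1.unique_side hk (by simpa using h.2) hpos)
    · simp
  · rw [if_neg hij]
    exact Finset.sum_eq_zero fun k _ => if_neg fun h => hij h.1.adj.1

open Classical in
theorem sum_posCell_right (hT : P.IsTriangulation) {i : ι} (hi : ¬ P.IsBoundary i) (w : ι → ℝ) :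
    ∑ j, ∑ k, (if P.PosCell i j k then w k else 0) =
      ∑ k, if P.contactGraph.Adj i k then w k else 0 := by
  rw [Finset.sum_comm]
  refine Finset.sum_congr rfl fun k _ => ?_
  by_cases hik : P.contactGraph.Adj i k
  · obtain ⟨j, hj, hneg⟩ := hT.exists_cell_side hi hik (neg_ne_zero.2 (one_ne_zero (α := ℝ)))
    rw [if_pos hik, Finset.sum_eq_single j, if_pos]
    · exact ⟨hj.swap, by rw [area2_swap]; linarith⟩
    · refine fun j' _ hne => if_neg fun h => hne (h.1.swap.unique_side hj ?_ hneg)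
      rw [area2_swap]
      linarith [h.2]
    · simp
  · rw [if_neg hik]
    exact Finset.sum_eq_zero fun k _ => if_neg fun h => hik h.1.adj.2.1

open Classical in
/-- The inradii of the cells define a stress that is in equilibrium at the interior vertices. -/
theorem sum_inradius_perimeter_eq_zero (hT : P.IsTriangulation) {u : ι → Plane}
    (hu : ∀ i, P.IsBoundary i → u i = 0) :
    ∑ i, ∑ j, ∑ k, (if P.PosCell i j k then P.inradius i j k *
      (P.stretch u s(i, j) + P.stretch u s(j, k) + P.stretch u s(k, i)) else 0) = 0 := by
  -- The work of the cell force at the corner `i`. The weighted stretch of a cell is minus the sum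
  -- of the works at its three corners.
  let T : ι → ι → ι → ℝ := fun i j k => if P.PosCell i j k then
    P.inradius i j k * inner ℝ (u i) (P.q i j + P.q i k) else 0
  have hT0 : ∑ i, ∑ j, ∑ k, T i j k = 0 := by
    refine Finset.sum_eq_zero fun i _ => ?_
    by_cases hi : P.IsBoundary i
    · simp [T, hu i hi]
    · have h1 : ∀ j k, T i j k =
          (if P.PosCell i j k then P.a i * inner ℝ (u i) (rotJ (P.q i j)) else 0) -
          (if P.PosCell i j k then P.a i * inner ℝ (u i) (rotJ (P.q i k)) else 0) := by
        intro j k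
        by_cases h : P.PosCell i j k
        · have h2 := congrArg (fun v => inner ℝ (u i) v)
            (inradius_smul_add h.1.adj.1 h.1.adj.2.1 h.1.adj.2.2)
          simp only [real_inner_smul_right] at h2
          have h3 : rotJ (P.q i j - P.q i k) = rotJ (P.q i j) - rotJ (P.q i k) := by
            apply plane_ext <;> simp [rotJ]; ring
          rw [h3, inner_sub_right] at h2
          simp only [T, if_pos h, h2]
          ring
        · simp [T, h]
      simp only [h1, Finset.sum_sub_distrib]
      rw [sum_posCell_left hT hi fun j => P.a i * inner ℝ (u i) (rotJ (P.q i j)),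
        sum_posCell_right hT hi fun k => P.a i * inner ℝ (u i) (rotJ (P.q i k)), sub_self]
  have hsplit : ∀ i j k, (if P.PosCell i j k then P.inradius i j k *
      (P.stretch u s(i, j) + P.stretch u s(j, k) + P.stretch u s(k, i)) else 0) =
      -(T i j k + T j k i + T k i j) := by
    intro i j k
    by_cases h : P.PosCell i j k
    · simp only [T, if_pos h, if_pos h.rotate, if_pos h.rotate.rotate, stretch_mk,
        inradius_rotate i j k, inradius_rotate j k i, P.q_swap i j, P.q_swap j k, P.q_swap k i,
        inner_sub_left, inner_add_right, inner_neg_right]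
      ring
    · simp [T, h, posCell_rotate_iff (i := i) (j := j) (k := k),
        posCell_rotate_iff (i := j) (j := k) (k := i)]
  have h2 : ∑ i, ∑ j, ∑ k, T j k i = 0 := by
    rw [Finset.sum_comm]
    simp_rw [Finset.sum_comm (γ := ι) (s := Finset.univ) (t := Finset.univ)
      (f := fun x y => T _ y x)]
    exact hT0
  have h3 : ∑ i, ∑ j, ∑ k, T k i j = 0 := by
    rw [← hT0]
    calc ∑ i, ∑ j, ∑ k, T k i j = ∑ i, ∑ k, ∑ j, T k i j :=
          Finset.sum_congr rfl fun i _ => Finset.sum_comm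
      _ = ∑ k, ∑ i, ∑ j, T k i j := Finset.sum_comm
  simp only [hsplit, Finset.sum_neg_distrib, Finset.sum_add_distrib, hT0, h2, h3]
  simp

/-- A displacement that vanishes on the boundary and does not shorten any edge does not change the
length of any edge. -/
theorem stretch_eq_zero_of_nonneg (hT : P.IsTriangulation) {u : ι → Plane}
    (hu : ∀ i, P.IsBoundary i → u i = 0)
    (hs : ∀ i j, P.contactGraph.Adj i j → 0 ≤ P.stretch u s(i, j)) {i j : ι}
    (hij : P.contactGraph.Adj i j) : P.stretch u s(i, j) = 0 := by
  classical
  have hnn : ∀ i j k, 0 ≤ (if P.PosCell i j k then P.inradius i j k *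
      (P.stretch u s(i, j) + P.stretch u s(j, k) + P.stretch u s(k, i)) else 0) := by
    intro i j k
    split_ifs with h
    · exact mul_nonneg h.inradius_pos.le (add_nonneg (add_nonneg (hs _ _ h.1.adj.1)
        (hs _ _ h.1.adj.2.2)) (hs _ _ h.1.adj.2.1.symm))
    · exact le_rfl
  have key : ∀ i j k, P.PosCell i j k → P.stretch u s(i, j) = 0 := by
    intro i j k h
    have h0 := sum_inradius_perimeter_eq_zero hT hu
    have h1 := (Finset.sum_eq_zero_iff_of_nonneg fun i _ => Finset.sum_nonneg fun j _ =>
      Finset.sum_nonneg fun k _ => hnn i j k).1 h0 i (Finset.mem_univ i)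
    have h2 := (Finset.sum_eq_zero_iff_of_nonneg fun j _ =>
      Finset.sum_nonneg fun k _ => hnn i j k).1 h1 j (Finset.mem_univ j)
    have h3 := (Finset.sum_eq_zero_iff_of_nonneg fun k _ => hnn i j k).1 h2 k (Finset.mem_univ k)
    rw [if_pos h] at h3
    have h4 := (mul_eq_zero.1 h3).resolve_left h.inradius_pos.ne'
    linarith [hs _ _ h.1.adj.1, hs _ _ h.1.adj.2.2, hs _ _ h.1.adj.2.1.symm]
  obtain ⟨t, ht, hi, hj⟩ := hT.edge_mem i j hij
  obtain ⟨k, hk⟩ := ht.exists_third hi hj hij.ne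
  rcases hk.area2_ne_zero.lt_or_gt with h | h
  · rw [Sym2.eq_swap]
    refine key j i k ⟨hk.swap.rotate.rotate, ?_⟩
    rw [area2_swap_left]
    linarith
  · exact key i j k ⟨hk, h⟩

end Stress

/-! ### Infinitesimal rigidity -/

section Rigidity

theorem cross_eq_zero_of_inner {v e f : Plane} (he : inner ℝ v e = 0) (hf : inner ℝ v f = 0)
    (hef : cross e f ≠ 0) : v = 0 := by
  rw [plane_inner] at he hf
  have h0 : v 0 * cross e f = 0 := by
    unfold cross
    linear_combination f 1 * he - e 1 * hf
  have h1 : v 1 * cross e f = 0 := by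
    unfold cross
    linear_combination e 0 * hf - f 0 * he
  exact plane_ext ((mul_eq_zero.1 h0).resolve_right hef) ((mul_eq_zero.1 h1).resolve_right hef)

theorem inner_rotK_self (v : Plane) : inner ℝ (rotK v) v = 0 := by
  rw [plane_inner]
  simp [rotK]
  ring

theorem rotK_sub (u v : Plane) : rotK (u - v) = rotK u - rotK v := by
  apply plane_ext <;> simp [rotK]
  ring

theorem eq_zero_of_rotK_eq_zero {v : Plane} (h : rotK v = 0) : v = 0 := by
  have h0 : v 1 = 0 := congrFun (congrArg WithLp.ofLp h) 0
  have h1 : -v 0 = 0 := congrFun (congrArg WithLp.ofLp h) 1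
  exact plane_ext (neg_eq_zero.1 h1) h0

theorem inner_sub_eq_zero_of_stretch {u : ι → Plane} {i j : ι} (h : P.contactGraph.Adj i j)
    (hs : P.stretch u s(i, j) = 0) : inner ℝ (u j - u i) (P.x j - P.x i) = 0 := by
  rw [stretch_mk, q_of_adj h, real_inner_smul_right] at hs
  have := P.radius_pos i
  have := P.radius_pos j
  exact (mul_eq_zero.1 hs).resolve_left (by positivity)

/-- If an infinitesimally rigid motion agrees with `u` at two vertices of a triangle whose sides keep
their lengths, then it agrees with `u` at the third vertex. -/
theorem rigid_third {u : ι → Plane} {c : Plane} {α : ℝ} {i j k : ι}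
    (hij : P.contactGraph.Adj i j) (hik : P.contactGraph.Adj i k) (hjk : P.contactGraph.Adj j k)
    (sik : P.stretch u s(i, k) = 0) (sjk : P.stretch u s(j, k) = 0)
    (hi : u i = c + α • rotK (P.x i)) (hj : u j = c + α • rotK (P.x j)) :
    u k = c + α • rotK (P.x k) := by
  -- The discrepancy at `k` is orthogonal to the two sides meeting there, which are independent.
  have key : ∀ l, P.contactGraph.Adj l k → P.stretch u s(l, k) = 0 →
      u l = c + α • rotK (P.x l) →
      inner ℝ (u k - (c + α • rotK (P.x k))) (P.x k - P.x l) = 0 := by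
    intro l hlk sl hl
    have h1 := inner_sub_eq_zero_of_stretch hlk sl
    have h2 : u k - (c + α • rotK (P.x k)) = (u k - u l) - α • rotK (P.x k - P.x l) := by
      rw [hl, rotK_sub]
      module
    rw [h2, inner_sub_left, h1, real_inner_smul_left, inner_rotK_self]
    simp
  have hD : cross (P.x k - P.x i) (P.x k - P.x j) ≠ 0 := by
    have : cross (P.x k - P.x i) (P.x k - P.x j) = P.area2 i j k := by
      simp [area2, cross]
      ring
    rw [this]
    exact area2_ne_zero hij hik hjk
  exact sub_eq_zero.1 (cross_eq_zero_of_inner (key i hik sik hi) (key j hjk sjk hj) hD)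

/-- The relative displacement is orthogonal to the edge, hence a multiple `α` of the rotated edge
vector; `c` is then fixed by the value at `i`. -/
theorem exists_rigid_of_edge {u : ι → Plane} {i j : ι} (hij : P.contactGraph.Adj i j)
    (sij : P.stretch u s(i, j) = 0) :
    ∃ (c : Plane) (α : ℝ), u i = c + α • rotK (P.x i) ∧ u j = c + α • rotK (P.x j) := by
  have h1 := inner_sub_eq_zero_of_stretch hij sij
  have h2 := norm_sub_of_adj hij
  have hpos : 0 < ‖P.x j - P.x i‖ := by
    rw [h2]
    exact add_pos (P.radius_pos i) (P.radius_pos j)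
  have hn := plane_norm_sq (P.x j - P.x i)
  obtain ⟨v, hv⟩ : ∃ v, v = P.x j - P.x i := ⟨_, rfl⟩
  obtain ⟨w, hw⟩ : ∃ w, w = u j - u i := ⟨_, rfl⟩
  rw [← hv] at h1 hpos hn
  rw [← hw, plane_inner] at h1
  obtain ⟨α, hα⟩ : ∃ α, α = inner ℝ w (rotK v) / ‖v‖ ^ 2 := ⟨_, rfl⟩
  have hwv : w = α • rotK v := by
    rw [plane_inner, hn] at hα
    have hne : v 0 ^ 2 + v 1 ^ 2 ≠ 0 := hn ▸ (pow_pos hpos 2).ne'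
    apply plane_ext <;> simp [hα, rotK] <;> field_simp
    · linear_combination v 0 * h1
    · linear_combination v 1 * h1
  refine ⟨u i - α • rotK (P.x i), α, by simp, ?_⟩
  have h3 : u j = u i + w := by rw [hw]; abel
  rw [h3, hwv, hv, rotK_sub]
  module

theorem triangleGraph_adj_iff {i j k a b : ι} : (triangleGraph i j k).Adj a b ↔
    a ≠ b ∧ (s(a, b) = s(i, j) ∨ s(a, b) = s(j, k) ∨ s(a, b) = s(i, k)) := by
  simp [triangleGraph, and_comm]

theorem mem_of_triangleGraph_adj {i j k a b : ι} (h : (triangleGraph i j k).Adj a b) :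
    a = i ∨ a = j ∨ a = k := by
  have := (triangleGraph_adj_iff.1 h).2
  simp only [Sym2.eq_iff] at this
  tauto

/-- A displacement that keeps the edge lengths of a graph built from triangles is an infinitesimal
rigid motion on the vertices of the graph. -/
theorem exists_rigid_of_built {u : ι → Plane} {G : SimpleGraph ι} (hG : BuiltByTriangles G)
    (h : ∀ i j, G.Adj i j → P.contactGraph.Adj i j ∧ P.stretch u s(i, j) = 0) :
    ∃ (c : Plane) (α : ℝ), ∀ i j, G.Adj i j → u i = c + α • rotK (P.x i) := by
  induction hG with
  | single i j k hij hjk hik =>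
    obtain ⟨aij, sij⟩ := h i j (triangleGraph_adj_iff.2 ⟨hij, by simp⟩)
    obtain ⟨ajk, sjk⟩ := h j k (triangleGraph_adj_iff.2 ⟨hjk, by simp⟩)
    obtain ⟨aik, sik⟩ := h i k (triangleGraph_adj_iff.2 ⟨hik, by simp⟩)
    obtain ⟨c, α, hi, hj⟩ := exists_rigid_of_edge aij sij
    refine ⟨c, α, fun a b hab => ?_⟩
    rcases mem_of_triangleGraph_adj hab with rfl | rfl | rfl
    · exact hi
    · exact hj
    · exact rigid_third aij aik ajk sik sjk hi hj
  | addVertex G i j k hG hij hk ih =>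
    obtain ⟨c, α, hrig⟩ := ih fun i j hij => h i j (Or.inl hij)
    have hjk : j ≠ k := by
      rintro rfl
      exact hk i hij.symm
    have hik : i ≠ k := by
      rintro rfl
      exact hk j hij
    obtain ⟨aij, sij⟩ := h i j (Or.inl hij)
    obtain ⟨ajk, sjk⟩ := h j k (Or.inr (triangleGraph_adj_iff.2 ⟨hjk, by simp⟩))
    obtain ⟨aik, sik⟩ := h i k (Or.inr (triangleGraph_adj_iff.2 ⟨hik, by simp⟩))
    refine ⟨c, α, fun a b hab => ?_⟩
    rcases hab with hab | hab
    · exact hrig a b hab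
    rcases mem_of_triangleGraph_adj hab with rfl | rfl | rfl
    · exact hrig _ _ hij
    · exact hrig _ _ hij.symm
    · exact rigid_third aij aik ajk sik sjk (hrig _ _ hij) (hrig _ _ hij.symm)
  | addEdge G i j k hG hij hjk hne hik ih =>
    -- A chord brings no new vertex, so the motion found so far already covers its ends.
    obtain ⟨c, α, hrig⟩ := ih fun i j hij => h i j (Or.inl hij)
    refine ⟨c, α, fun a b hab => ?_⟩
    rcases hab with hab | hab
    · exact hrig a b hab
    rcases mem_of_triangleGraph_adj hab with rfl | rfl | rfl
    · exact hrig _ _ hij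
    · exact hrig _ _ hjk
    · exact hrig _ _ hjk.symm

/-- The region lies in every half plane that contains the centers. -/
theorem region_subset_halfPlane {m : ℝ} (hm : ∀ i, P.x i 0 ≤ m) :
    P.region ⊆ {y : Plane | y 0 ≤ m} := by
  refine Set.iUnion₂_subset fun t _ => convexHull_min ?_ ?_
  · rintro _ ⟨i, -, rfl⟩
    exact hm i
  · exact convex_halfSpace_le ⟨fun x y => by simp, fun c x => by simp⟩ m

-- A rightmost center is on the boundary: around an interior one the region would extend further to
-- the right, beyond the half plane containing all centers.
open Filter Topology in
theorem IsTriangulation.exists_isBoundary [Finite ι] [DecidableEq ι] [Nonempty ι]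
    (hT : P.IsTriangulation) : ∃ i, P.IsBoundary i := by
  obtain ⟨i, hi⟩ := Finite.exists_max fun i => P.x i 0
  by_contra! hcon
  have hnhds := mem_interior_iff_mem_nhds.1 (hT.mem_interior (hcon i))
  let y : ℝ → Plane := fun t => P.x i + t • EuclideanSpace.single 0 1
  have hy : Continuous y := by fun_prop
  have hyt : Tendsto y (𝓝[>] 0) (𝓝 (P.x i)) := by
    have := hy.tendsto 0
    simp only [y, zero_smul, add_zero] at this
    exact this.mono_left nhdsWithin_le_nhds
  obtain ⟨t, ht, htpos⟩ := ((hyt.eventually hnhds).and self_mem_nhdsWithin).exists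
  have htpos : 0 < t := htpos
  have h1 : y t 0 ≤ P.x i 0 := region_subset_halfPlane hi ht
  simp [y] at h1
  linarith

end Rigidity

/-! ### Trivial recession cone and solid contacts -/

theorem extendInt_of_isBoundary (z : P.IntVertex → Plane) {i : ι} (hi : P.IsBoundary i) :
    P.extendInt z i = 0 := by
  simp [extendInt, hi]

theorem extendInt_of_not_isBoundary (z : P.IntVertex → Plane) (i : P.IntVertex) :
    P.extendInt z i = z i := by
  simp [extendInt, i.2]

theorem R_apply (z : P.IntVertex → Plane) {i j : ι} (h : P.contactGraph.Adj i j) :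
    P.R z ⟨s(i, j), h⟩ = P.stretch (P.extendInt z) s(i, j) := rfl

/-- The only displacement of the interior vertices that does not shorten any edge is zero. -/
theorem eq_zero_of_R_nonneg [Fintype ι] [DecidableEq ι] (B : P.BoundaryMotion)
    (hA2 : P.IsRegularTriangulation) (w : P.IntVertex → Plane) (hw : ∀ e, 0 ≤ P.R w e) :
    w = 0 := by
  rcases isEmpty_or_nonempty ι with hι | hι
  · exact Subsingleton.elim _ _
  have hT := hA2.triangulation
  have hs : ∀ i j, P.contactGraph.Adj i j → P.stretch (P.extendInt w) s(i, j) = 0 := fun i j hij =>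
    stretch_eq_zero_of_nonneg hT (fun i hi => extendInt_of_isBoundary w hi)
      (fun i j hij => R_apply w hij ▸ hw _) hij
  obtain ⟨c, α, hrig⟩ := exists_rigid_of_built hA2.built fun i j hij => ⟨hij, hs i j hij⟩
  have hrig' : ∀ i, P.extendInt w i = c + α • rotK (P.x i) := by
    intro i
    obtain ⟨t, ht, hit⟩ := hT.vertex_mem i
    obtain ⟨j, k, hc, -⟩ := ht.exists_eq hit
    exact hrig i j hc.adj.1
  -- Two touching boundary vertices have zero displacement; comparing them kills the rotation, then
  -- the translation.
  obtain ⟨b, hb⟩ := hT.exists_isBoundary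
  obtain ⟨⟨b', hb'⟩, hadj, -⟩ := B.contact_in_group ⟨b, hb⟩
  have h1 := hrig' b
  have h2 := hrig' b'
  rw [extendInt_of_isBoundary w hb] at h1
  rw [extendInt_of_isBoundary w hb'] at h2
  have h3 : α • rotK (P.x b' - P.x b) = 0 := by
    have : α • rotK (P.x b' - P.x b) =
        (c + α • rotK (P.x b')) - (c + α • rotK (P.x b)) := by
      rw [rotK_sub]
      module
    rw [this, ← h1, ← h2, sub_zero]
  have hα : α = 0 := by
    refine (smul_eq_zero.1 h3).resolve_right fun h4 => hadj.1 ?_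
    have h5 : P.x b' - P.x b = 0 := eq_zero_of_rotK_eq_zero h4
    have h6 := norm_sub_of_adj hadj
    change ‖P.x b' - P.x b‖ = P.a b + P.a b' at h6
    rw [h5, norm_zero] at h6
    linarith [P.radius_pos b, P.radius_pos b']
  have hc : c = 0 := by simpa [hα] using h1.symm
  funext i
  rw [← extendInt_of_not_isBoundary w i, hrig', hα, hc]
  simp

theorem inner_eq_zero_of_not_linearIndependent {p q : Plane} {v : Plane} (hp : p ≠ 0)
    (hpq : ¬ LinearIndependent ℝ ![p, q]) (hv : inner ℝ v p = 0) : inner ℝ v q = 0 := by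
  rw [LinearIndependent.pair_iff' hp] at hpq
  push Not at hpq
  obtain ⟨c, rfl⟩ := hpq
  rw [real_inner_smul_right, hv, mul_zero]

theorem q_ne_zero {i j : ι} (h : P.contactGraph.Adj i j) : P.q i j ≠ 0 := by
  have h1 := norm_sub_of_adj h
  have h2 : 0 < P.a i + P.a j := add_pos (P.radius_pos i) (P.radius_pos j)
  rw [q_of_adj h]
  refine smul_ne_zero (by positivity) fun h3 => ?_
  rw [h3, norm_zero] at h1
  exact h2.ne h1

/-- At a vertex of the feasible polyhedron every interior particle has two solid contacts in
independent directions. -/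
theorem twoSolidContacts_of_mem_polyVertices [Fintype P.IntVertex] (B : P.BoundaryMotion)
    {z : P.IntVertex → Plane} (hz : z ∈ polyVertices P.R B.aVec) : B.TwoSolidContacts z := by
  classical
  intro i
  by_contra! hcon
  -- If the active directions at `i` span at most a line, some nonzero `v` is orthogonal to all of
  -- them. Moving `i` alone by `v` preserves every active constraint, against full rank.
  obtain ⟨v, hv0, hv⟩ : ∃ v : Plane, v ≠ 0 ∧ ∀ j, B.IsActive z i j → inner ℝ v (P.q i j) = 0 := by
    by_cases hex : ∃ j, B.IsActive z i j
    · obtain ⟨j, hj⟩ := hex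
      have hq := q_ne_zero hj.1
      refine ⟨rotK (P.q i j), fun h => hq (eq_zero_of_rotK_eq_zero h), fun k hk =>
        inner_eq_zero_of_not_linearIndependent hq (hcon j k hj hk) (inner_rotK_self _)⟩
    · exact ⟨EuclideanSpace.single 0 1, by simp, fun j hj => absurd ⟨j, hj⟩ hex⟩
  obtain ⟨w, hwi, hwk⟩ : ∃ w : P.IntVertex → Plane, w i = v ∧ ∀ k, k ≠ i → w k = 0 :=
    ⟨Function.update 0 i v, by simp, fun k hk => by simp [hk]⟩
  have hw : w = 0 := by
    refine hz.2 w ?_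
    have hext : ∀ k : ι, k ≠ i → P.extendInt w k = 0 := by
      intro k hk
      by_cases hb : P.IsBoundary k
      · exact extendInt_of_isBoundary _ hb
      · rw [extendInt_of_not_isBoundary _ ⟨k, hb⟩]
        exact hwk _ fun h => hk (congrArg Subtype.val h)
    have hexti : P.extendInt w i = v := by
      rw [extendInt_of_not_isBoundary, hwi]
    have key : ∀ (k : ι) (h : P.contactGraph.Adj i k),
        P.R z ⟨s((i : ι), k), h⟩ + B.aVec ⟨s((i : ι), k), h⟩ = 0 →
        P.stretch (P.extendInt w) s((i : ι), k) = 0 := by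
      intro k h h0
      rw [stretch_mk, hexti, hext k h.ne', zero_sub, inner_neg_left, hv k ⟨h, h0⟩, neg_zero]
    rintro ⟨e, he⟩ h0
    induction e with
    | _ k l =>
      rw [R_apply _ he]
      by_cases hk : k = i
      · subst hk
        exact key l he h0
      by_cases hl : l = i
      · subst hl
        have hadj : P.contactGraph.Adj i k := SimpleGraph.Adj.symm he
        have hswap : (⟨s(k, (i : ι)), he⟩ : P.Edge) = ⟨s((i : ι), k), hadj⟩ :=
          Subtype.ext Sym2.eq_swap
        rw [hswap] at h0
        rw [Sym2.eq_swap]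
        exact key k hadj h0
      · rw [stretch_mk, hext k hk, hext l hl]
        simp
  exact hv0 (by rw [← hwi, hw, Pi.zero_apply])

theorem ae_exists_uniqueSolidMinimizer [Fintype ι] [DecidableEq ι] (B : P.BoundaryMotion)
    (hA1_feasible : ∃ z, B.Feasible z) (hA2 : P.IsRegularTriangulation) :
    ∀ᵐ δ : P.Edge → ℝ, ∃ dstar : ℝ, 0 < dstar ∧ ∀ d : ℝ, dstar < d →
      B.UniqueSolidMinimizer d δ := by
  have : Fintype P.IntVertex := Fintype.ofFinite _
  have hK := eq_zero_of_R_nonneg B hA2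
  -- Injectivity of `R` is the special case R w = 0 of the recession cone statement.
  filter_upwards [ae_separates P.R B.aVec fun w hw => hK w fun e => by rw [hw]; exact le_rfl]
    with δ hδ
  obtain ⟨v, hv, D, hD, hmin⟩ := exists_vertex_minimizer P.R B.aVec hK hA1_feasible δ hδ
  refine ⟨D, hD, fun d hd => ?_⟩
  have hd0 : 0 < 1 / 2 * (d ^ 3)⁻¹ := by
    have : 0 < d := hD.trans hd
    positivity
  have hlt : ∀ z, B.Feasible z → z ≠ v → B.F d δ v < B.F d δ z := fun z hz hzv =>
    mul_lt_mul_of_pos_left (hmin d hd z hz hzv) hd0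
  refine ⟨v, ⟨hv.1, fun z hz => ?_⟩, fun z hz => ?_, twoSolidContacts_of_mem_polyVertices B hv⟩
  · by_cases hzv : z = v
    · rw [hzv]
    · exact (hlt z hz hzv).le
  · by_contra hzv
    exact (hlt z hz.1 hzv).not_ge (hz.2 v hv.1)

end DiskPacking

end Granular

theorem theorem5p1 {ι : Type*} [Fintype ι] [DecidableEq ι] (P : Granular.DiskPacking ι)
    (B : P.BoundaryMotion)
    (hA1_infeasible : ∃ d : ℝ, 0 < d ∧ ∃ δ : P.Edge → ℝ, (∀ e, δ e ∈ Set.Icc (-1 : ℝ) (-1 / 2)) ∧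
      ∃ z, B.IsUnconstrainedMinimizer d δ z ∧ ¬ B.Feasible z)
    (hA1_feasible : ∃ z, B.Feasible z)
    (hA2 : P.IsRegularTriangulation)
    (hA3 : B.NoGaps) :
    (∃ dstar : ℝ, 0 < dstar ∧ ∃ δ : P.Edge → ℝ, (∀ e, δ e ∈ Set.Ioo (-1 : ℝ) (-1 / 2)) ∧
      ∀ d : ℝ, dstar < d → B.UniqueSolidMinimizer d δ) ∧
    (∀ᵐ δ : P.Edge → ℝ, (∀ e, δ e ∈ Set.Ioo (-1 : ℝ) (-1 / 2)) →
      ∃ dstar : ℝ, 0 < dstar ∧ ∀ d : ℝ, dstar < d → B.UniqueSolidMinimizer d δ) := by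
  have hae := Granular.DiskPacking.ae_exists_uniqueSolidMinimizer B hA1_feasible hA2
  refine ⟨?_, hae.mono fun δ h _ => h⟩
  have hopen : IsOpen (Set.univ.pi fun _ : P.Edge => Set.Ioo (-1 : ℝ) (-1 / 2)) :=
    isOpen_set_pi Set.finite_univ fun _ _ => isOpen_Ioo
  -- A set of full measure is dense, so it meets the nonempty open box.
  obtain ⟨δ, hδ, dstar, hd, h⟩ := (MeasureTheory.Measure.dense_of_ae hae).inter_open_nonempty _
    hopen ⟨fun _ => -3 / 4, fun _ _ => by constructor <;> norm_num⟩
  exact ⟨dstar, hd, δ, fun e => hδ e trivial, h⟩
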